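/- **Conventions.** A set $X$ with a distance function $d$ has *property A* if for all $\varepsilon,R>0$ there are $S>0$ and finite non-empty sets $A_x\subset X\times\mathbb N$ ($x\in X$) such that $d(x,y)<S$ for all $(y,j)\in A_x$, and $|A_x\,\triangle\,A_y|/|A_x|<\varepsilon$ whenever $d(x,y)<R$. A countable group has property A if it has property A for a proper left-invariant metric. Let $G$ be a group with a proper left-invariant metric $d_G$ and length $\ell_G(g)=d_G(e,g)$, and let $\mathcal H=\{H_i\}_{i\in I}$ be a finite family of subgroups. $G$ has *relative property A* with respect to $\mathcal H$ if there is a countable $G$-set $K$ with finitely many orbits, whose point stabilizers are precisely the conjugates of the $H_i$, with a set $\mathcal R\subset K$ of representatives of the orbits, such that for all $\varepsilon,R>0$ there are $S>0$ and finite non-empty sets $A_x\subset K\times\mathbb N$ ($x\in G$) with $\rho(x,k)<S$ for all $(k,j)\in A_x$, and $|A_x\,\triangle\,A_y|/|A_x|<\varepsilon$ whenever $d_G(x,y)<R$. Here $\rho(x,k)=\min\{\ell_G(g): x^{-1}k=gr \text{ for some } r\in\mathcal R\}$. Complexes of groups, their developability, and their fundamental groups are understood in the sense of Bridson and Haefliger: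 a complex of groups $\mathcal Y=(G_\sigma,\psi_a,g_{a,b})$ over a small category without loops (scwol) $Y$ is *developable* if it is isomorphic to the complex of groups associated to an action of a group on a scwol with quotient $Y$, and for a maximal tree $T$ of $Y$ the group $\pi_1(\mathcal Y,T)$ is generated by the elements of all $G_\sigma$ and the edges of $Y$ subject to the relations of the groups $G_\sigma$, $a g a^{-1}=\psi_a(g)$, $ab=g_{a,b}\,(ab)$ (on the right $(ab)$ is the composite edge), and $a=1$ for $a\in T$. The *development* is the scwol $X$ with vertices the pairs $(gG_\sigma,\sigma)$ and with edges the pairs $(gG_{\sigma},a)$, leading from $(gG_{\sigma},\sigma)$ to $(ga^{-1}G_{\tau},\tau)$ for every edge $a$ of $Y$ from $\sigma$ to $\tau$, where $g\in\pi_1(\mathcal Y,T)$ and $G_\sigma$ stands for its image in $\pi_1(\mathcal Y,T)$. It is *locally finite* if every vertex is on finitely many edges, and it has property A if its vertex set does for the path metric of the 1-skeleton. A *0-cell* of $Y$ is a vertex that is not the initial vertex of any edge (in the scwol of cells of a polyhedral complex, the edges lead from a cell to its proper faces). **Corollary.** Let $\mathcal Y$ be a developable complex of groups over a finite-dimensional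 scwol $Y$ (non-empty and connected), $T$ a maximal tree of $Y$, and $G=\pi_1(\mathcal Y,T)$. Suppose that $G$ is finitely generated and that the development is locally finite and has property A. Then: 1. For every proper left-invariant metric on $G$, the group $G$ has relative property A with respect to every non-empty finite family of vertex groups, that is, $\{G_{\sigma_j}\}_{j\in J}$ for any non-empty finite family $(\sigma_j)_{j\in J}$ of vertices of $Y$. In particular, if $Y$ has finitely many vertices, this holds for the family of all the groups $G_\sigma$, and for the family of the groups of the 0-cells. 2. If the group $G_\sigma$ of every 0-cell $\sigma$ has property A (in particular, if every $G_\sigma$ has property A), then $G$ has property A. -/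

import Mathlib

universe u

/-! ## Property A and relative property A -/

/-- Yu's property A for a set `X` with distance function `d`. -/
def PropertyA {X : Type u} (d : X → X → ℝ) : Prop :=
  ∀ ε : ℝ, 0 < ε → ∀ R : ℝ, 0 < R → ∃ S : ℝ, 0 < S ∧ ∃ A : X → Set (X × ℕ),
    (∀ x, (A x).Finite ∧ (A x).Nonempty) ∧
    (∀ x, ∀ p ∈ A x, d x p.1 < S) ∧
    (∀ x y, d x y < R → ((symmDiff (A x) (A y)).ncard : ℝ) / ((A x).ncard : ℝ) < ε)

/-- A proper length function on a group, that is, the function `g ↦ d 1 g` of a proper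
left-invariant metric `d` (proper: balls are finite). -/
structure ProperLength (G : Type u) [Group G] where
  len : G → ℝ
  len_eq_zero_iff : ∀ g, len g = 0 ↔ g = 1
  len_inv : ∀ g, len g⁻¹ = len g
  len_mul_le : ∀ g h, len (g * h) ≤ len g + len h
  finite_ball : ∀ r : ℝ, {g | len g ≤ r}.Finite

/-- The proper left-invariant metric of a length function. -/
def ProperLength.dist {G : Type u} [Group G] (ℓ : ProperLength G) (x y : G) : ℝ :=
  ℓ.len (x⁻¹ * y)

/-- A (countable) group has property A if it has property A as a metric space, for a proper
left-invariant metric. (Any two such metrics on a group are coarsely equivalent, so that the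
choice of the metric does not matter.) -/
def HasPropertyA (G : Type u) [Group G] : Prop :=
  ∃ ℓ : ProperLength G, PropertyA ℓ.dist

/-- `relRho ℓ Rep x k` is the least length of an element `g` with `g • r = x⁻¹ • k`, where `r` is
the representative in `Rep` of the orbit of `k`. -/
noncomputable def relRho {G : Type u} [Group G] (ℓ : ProperLength G) {K : Type u} [MulAction G K]
    (Rep : Set K) (x : G) (k : K) : ℝ :=
  sInf {t : ℝ | ∃ g : G, (∃ r ∈ Rep, g • r = x⁻¹ • k) ∧ ℓ.len g = t}

/-- The group `G` with the proper left-invariant metric of `ℓ` has relative property A with respect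
to the finite family `H` of subgroups. -/
def RelativePropertyA {G : Type u} [Group G] (ℓ : ProperLength G) {I : Type u} [Finite I]
    (H : I → Subgroup G) : Prop :=
  ∃ (K : Type u) (_ : Countable K) (_ : MulAction G K),
    -- the action is cofinite
    Finite (MulAction.orbitRel.Quotient G K) ∧
    -- the point stabilizers are precisely the conjugates of the subgroups `H i`
    (Set.range fun k : K => MulAction.stabilizer G k) =
      {L : Subgroup G | ∃ (i : I) (g : G), L = (H i).map (MulAut.conj g).toMonoidHom} ∧
    -- a set of representatives of the orbits
    ∃ Rep : Set K, (∀ k : K, ∃! r : K, r ∈ Rep ∧ r ∈ MulAction.orbit G k) ∧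
      ∀ ε : ℝ, 0 < ε → ∀ R : ℝ, 0 < R → ∃ S : ℝ, 0 < S ∧ ∃ A : G → Set (K × ℕ),
        (∀ x, (A x).Finite ∧ (A x).Nonempty) ∧
        (∀ x, ∀ p ∈ A x, relRho ℓ Rep x p.1 < S) ∧
        (∀ x y, ℓ.dist x y < R →
          ((symmDiff (A x) (A y)).ncard : ℝ) / ((A x).ncard : ℝ) < ε)

/-! ## Small categories without loops -/

/-- A small category without loops (scwol). `E x y` is the set of edges with initial vertex `x`
and terminal vertex `y` (the non-identity morphisms); `comp a b` is the composition `ab`, `b`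
followed by `a`. -/
structure Scwol where
  V : Type u
  E : V → V → Type u
  comp : ∀ {x y z : V}, E y z → E x y → E x z
  assoc : ∀ {x y z w : V} (a : E z w) (b : E y z) (c : E x y),
    comp (comp a b) c = comp a (comp b c)
  no_loop : ∀ x, IsEmpty (E x x)

namespace Scwol

/-- The set of all edges. -/
def Edge (X : Scwol.{u}) : Type u := Σ x y : X.V, X.E x y

/-- The edge `a`, as an element of the set of all edges. -/
def edge (X : Scwol.{u}) {x y : X.V} (a : X.E x y) : X.Edge := ⟨x, y, a⟩

/-- The graph on the vertices whose edges are the elements of a set `T` of edges of the scwol, with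
their orientation forgotten. -/
def graphOf (X : Scwol.{u}) (T : Set X.Edge) : SimpleGraph X.V where
  Adj x y := (∃ a : X.E x y, X.edge a ∈ T) ∨ (∃ a : X.E y x, X.edge a ∈ T)
  symm := ⟨fun _ _ h => h.symm⟩
  loopless := ⟨fun x h => h.elim (fun ⟨a, _⟩ => (X.no_loop x).elim a)
    (fun ⟨a, _⟩ => (X.no_loop x).elim a)⟩

/-- The 1-skeleton of the geometric realization (up to multiplicity of edges). -/
def skeleton (X : Scwol.{u}) : SimpleGraph X.V := X.graphOf Set.univ

/-- `T` is (the set of edges of) a maximal tree in the 1-skeleton. It has at most one edge between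
two vertices, and it connects all the vertices without circuits. There is a maximal tree if and only
if the scwol is non-empty and connected. -/
def IsMaximalTree (X : Scwol.{u}) (T : Set X.Edge) : Prop :=
  (X.graphOf T).IsTree ∧
    ∀ {x y : X.V} (a b : X.E x y), X.edge a ∈ T → X.edge b ∈ T → a = b

/-- There is a bound on the lengths of the sequences of composable edges, that is, on the
dimensions of the simplices of the geometric realization. -/
def IsFiniteDimensional (X : Scwol.{u}) : Prop :=
  ∃ n : ℕ, ∀ (k : ℕ) (v : Fin (k + 1) → X.V),
    (∀ i : Fin k, Nonempty (X.E (v i.castSucc) (v i.succ))) → k ≤ n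

/-- The geometric realization is locally finite: each vertex is on finitely many edges. -/
def IsLocallyFinite (X : Scwol.{u}) : Prop :=
  ∀ x : X.V, Finite (Σ y, X.E x y) ∧ Finite (Σ y, X.E y x)

/-- The distance of two vertices in the 1-skeleton. -/
noncomputable def vertexDist (X : Scwol.{u}) (x y : X.V) : ℝ := X.skeleton.dist x y

/-- The vertices from which no edge issues. (In the scwol of a polyhedral complex the vertices are
the cells, and the edges lead from a cell to its proper faces, so that these are the 0-cells.) -/
def IsZeroCell (X : Scwol.{u}) (x : X.V) : Prop := ∀ y, IsEmpty (X.E x y)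

/-- Non-degenerate morphisms of scwols: functors that map edges to edges. -/
structure Hom (X Y : Scwol.{u}) where
  onV : X.V → Y.V
  onE : ∀ {x y : X.V}, X.E x y → Y.E (onV x) (onV y)
  map_comp : ∀ {x y z : X.V} (a : X.E y z) (b : X.E x y),
    onE (X.comp a b) = Y.comp (onE a) (onE b)

/-- The map on the set of all edges. -/
def Hom.onEdge {X Y : Scwol.{u}} (f : X.Hom Y) (e : X.Edge) : Y.Edge :=
  Y.edge (f.onE e.2.2)

/-- The monoid of endomorphisms; a monoid homomorphism from a group to it is a homomorphism to the
group of automorphisms. -/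
instance (X : Scwol.{u}) : Monoid (X.Hom X) where
  mul f g :=
    { onV := fun x => f.onV (g.onV x)
      onE := fun a => f.onE (g.onE a)
      map_comp := fun a b => by rw [g.map_comp, f.map_comp] }
  one := { onV := fun x => x, onE := fun a => a, map_comp := fun _ _ => rfl }
  mul_assoc _ _ _ := rfl
  one_mul _ := rfl
  mul_one _ := rfl

/-- Actions of a group on a scwol: no element maps the initial vertex of an edge to its terminal
vertex, and an element that fixes the initial vertex of an edge fixes the edge. -/
structure IsAction {Γ : Type u} [Group Γ] {X : Scwol.{u}} (ρ : Γ →* X.Hom X) : Prop where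
  map_initial_ne : ∀ (g : Γ) {x y : X.V}, X.E x y → (ρ g).onV x ≠ y
  fix_edge : ∀ (g : Γ) {x y : X.V} (a : X.E x y), (ρ g).onV x = x →
    (ρ g).onEdge (X.edge a) = X.edge a

/-- `p : X → Y` is the projection to the quotient of `X` by the action `ρ`. -/
structure IsQuotientMap {Γ : Type u} [Group Γ] {X Y : Scwol.{u}} (ρ : Γ →* X.Hom X)
    (p : X.Hom Y) : Prop where
  surj_V : Function.Surjective p.onV
  surj_E : Function.Surjective p.onEdge
  fiber_V : ∀ x x' : X.V, p.onV x = p.onV x' ↔ ∃ g : Γ, (ρ g).onV x = x'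
  fiber_E : ∀ e e' : X.Edge, p.onEdge e = p.onEdge e' ↔ ∃ g : Γ, (ρ g).onEdge e = e'

end Scwol

/-! ## Complexes of groups -/

/-- A complex of groups over the scwol `Y`: local groups `grp σ`, injective homomorphisms `ψ a`
from the local group of the initial vertex of the edge `a` to that of its terminal vertex, and
twisting elements `tw a b` for composable edges. -/
structure ComplexOfGroups (Y : Scwol.{u}) where
  grp : Y.V → Type u
  [inst : ∀ σ, Group (grp σ)]
  ψ : ∀ {σ τ : Y.V}, Y.E σ τ → (grp σ →* grp τ)
  ψ_injective : ∀ {σ τ : Y.V} (a : Y.E σ τ), Function.Injective (ψ a)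
  tw : ∀ {σ τ υ : Y.V}, Y.E τ υ → Y.E σ τ → grp υ
  tw_conj : ∀ {σ τ υ : Y.V} (a : Y.E τ υ) (b : Y.E σ τ) (g : grp σ),
    tw a b * ψ (Y.comp a b) g * (tw a b)⁻¹ = ψ a (ψ b g)
  cocycle : ∀ {σ τ υ ω : Y.V} (a : Y.E υ ω) (b : Y.E τ υ) (c : Y.E σ τ),
    ψ a (tw b c) * tw a (Y.comp b c) = tw a b * tw (Y.comp a b) c

attribute [instance] ComplexOfGroups.inst

namespace ComplexOfGroups

variable {Y : Scwol.{u}} (𝒢 : ComplexOfGroups Y)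

/-- The complex of groups is developable: up to isomorphism it is the complex of groups associated
to an action `ρ` of a group `Γ` on a scwol `X` with quotient `Y`. That complex of groups is
constructed from a choice of vertices `s σ` above the vertices `σ` of `Y`, and, for each edge `a`
of `Y`, of an element `h a` of `Γ` which maps the terminal vertex of the lift of `a` that starts at
`s σ` to the chosen vertex. The local groups are the stabilizers of the vertices `s σ` (here
identified with `grp σ` by the injective homomorphism `φ σ`), the homomorphisms are the
conjugations by the elements `h a`, and the twisting elements are `h a * h b * (h (ab))⁻¹`. -/
def IsDevelopable : Prop :=
  ∃ (Γ : Type u) (_ : Group Γ) (X : Scwol.{u}) (ρ : Γ →* X.Hom X) (p : X.Hom Y)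
    (s : Y.V → X.V) (h : ∀ {σ τ : Y.V}, Y.E σ τ → Γ) (φ : ∀ σ : Y.V, 𝒢.grp σ →* Γ),
    Scwol.IsAction ρ ∧ Scwol.IsQuotientMap ρ p ∧
    (∀ σ, p.onV (s σ) = σ) ∧
    (∀ {σ τ : Y.V} (a : Y.E σ τ) (y : X.V) (b : X.E (s σ) y),
      p.onEdge (X.edge b) = Y.edge a → (ρ (h a)).onV y = s τ) ∧
    (∀ σ, Function.Injective (φ σ)) ∧
    (∀ σ, Set.range (φ σ) = {g : Γ | (ρ g).onV (s σ) = s σ}) ∧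
    (∀ {σ τ : Y.V} (a : Y.E σ τ) (g : 𝒢.grp σ), φ τ (𝒢.ψ a g) = h a * φ σ g * (h a)⁻¹) ∧
    (∀ {σ τ υ : Y.V} (a : Y.E τ υ) (b : Y.E σ τ),
      φ υ (𝒢.tw a b) = h a * h b * (h (Y.comp a b))⁻¹)

/-- The generators of the fundamental group: the elements of the local groups, and the edges. -/
abbrev Gen : Type u := (Σ σ : Y.V, 𝒢.grp σ) ⊕ Y.Edge

/-- The generator given by an element of a local group, in the free group. -/
def genV {σ : Y.V} (g : 𝒢.grp σ) : FreeGroup 𝒢.Gen := FreeGroup.of (Sum.inl ⟨σ, g⟩)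

/-- The generator given by an edge, in the free group. -/
def genE {σ τ : Y.V} (a : Y.E σ τ) : FreeGroup 𝒢.Gen := FreeGroup.of (Sum.inr (Y.edge a))

/-- The defining relators of the fundamental group with respect to the maximal tree `T`. -/
inductive Rel (T : Set Y.Edge) : FreeGroup 𝒢.Gen → Prop
  | mul {σ : Y.V} (g h : 𝒢.grp σ) : Rel T (𝒢.genV g * 𝒢.genV h * (𝒢.genV (g * h))⁻¹)
  | conj {σ τ : Y.V} (a : Y.E σ τ) (g : 𝒢.grp σ) :
      Rel T (𝒢.genE a * 𝒢.genV g * (𝒢.genE a)⁻¹ * (𝒢.genV (𝒢.ψ a g))⁻¹)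
  | comp {σ τ υ : Y.V} (a : Y.E τ υ) (b : Y.E σ τ) :
      Rel T (𝒢.genE a * 𝒢.genE b * (𝒢.genV (𝒢.tw a b) * 𝒢.genE (Y.comp a b))⁻¹)
  | tree {σ τ : Y.V} (a : Y.E σ τ) (ha : Y.edge a ∈ T) : Rel T (𝒢.genE a)

/-- The fundamental group of the complex of groups, with respect to the maximal tree `T`. -/
abbrev FundamentalGroup (T : Set Y.Edge) : Type u := PresentedGroup {r | 𝒢.Rel T r}

variable (T : Set Y.Edge)

/-- The element of the fundamental group given by an edge. -/
def edgeElt {σ τ : Y.V} (a : Y.E σ τ) : 𝒢.FundamentalGroup T :=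
  PresentedGroup.mk {r | 𝒢.Rel T r} (𝒢.genE a)

/-- The canonical homomorphism from a local group to the fundamental group. -/
def ι (σ : Y.V) : 𝒢.grp σ →* 𝒢.FundamentalGroup T :=
  MonoidHom.mk' (fun g => PresentedGroup.mk {r | 𝒢.Rel T r} (𝒢.genV g)) fun g h => by
    have := PresentedGroup.mk_eq_one_iff.2
      (Subgroup.subset_normalClosure (show _ ∈ {r | 𝒢.Rel T r} from Rel.mul g h))
    rw [map_mul, map_inv, mul_inv_eq_one, map_mul] at this
    exact this.symm

theorem ι_ψ {σ τ : Y.V} (a : Y.E σ τ) (g : 𝒢.grp σ) :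
    𝒢.ι T τ (𝒢.ψ a g) = 𝒢.edgeElt T a * 𝒢.ι T σ g * (𝒢.edgeElt T a)⁻¹ := by
  have := PresentedGroup.mk_eq_one_iff.2
    (Subgroup.subset_normalClosure (show _ ∈ {r | 𝒢.Rel T r} from Rel.conj a g))
  rw [map_mul, map_inv, mul_inv_eq_one, map_mul, map_mul, map_inv] at this
  exact this.symm

theorem edgeElt_mul {σ τ υ : Y.V} (a : Y.E τ υ) (b : Y.E σ τ) :
    𝒢.edgeElt T a * 𝒢.edgeElt T b = 𝒢.ι T υ (𝒢.tw a b) * 𝒢.edgeElt T (Y.comp a b) := by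
  have := PresentedGroup.mk_eq_one_iff.2
    (Subgroup.subset_normalClosure (show _ ∈ {r | 𝒢.Rel T r} from Rel.comp a b))
  rw [map_mul, map_inv, mul_inv_eq_one, map_mul, map_mul] at this
  exact this

/-- The image of the local group at `σ` in the fundamental group. -/
def localSubgroup (σ : Y.V) : Subgroup (𝒢.FundamentalGroup T) := (𝒢.ι T σ).range

/-- For an edge `a` from `σ` to `τ`, the map `g G_σ ↦ g a⁻¹ G_τ` of cosets. -/
def move {σ τ : Y.V} (a : Y.E σ τ) :
    𝒢.FundamentalGroup T ⧸ 𝒢.localSubgroup T σ → 𝒢.FundamentalGroup T ⧸ 𝒢.localSubgroup T τ :=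
  Quotient.map' (fun g => g * (𝒢.edgeElt T a)⁻¹) fun g g' h => by
    rw [QuotientGroup.leftRel_apply] at h ⊢
    obtain ⟨x, hx⟩ := h
    refine ⟨𝒢.ψ a x, ?_⟩
    rw [ι_ψ, hx]
    group

theorem move_comp {σ τ υ : Y.V} (a : Y.E τ υ) (b : Y.E σ τ)
    (c : 𝒢.FundamentalGroup T ⧸ 𝒢.localSubgroup T σ) :
    𝒢.move T (Y.comp a b) c = 𝒢.move T a (𝒢.move T b c) := by
  induction c using Quotient.inductionOn' with
  | h g =>
    refine Quotient.sound' ?_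
    rw [QuotientGroup.leftRel_apply]
    refine ⟨(𝒢.tw a b)⁻¹, ?_⟩
    have h := 𝒢.edgeElt_mul T a b
    rw [map_inv, eq_mul_inv_of_mul_eq h.symm]
    group

/-- The (universal) development of the complex of groups. Its vertices are the pairs
`(g G_σ, σ)`. For each edge `a` of `Y` with initial vertex `σ` and terminal vertex `τ` and for each
coset `g G_σ` it has an edge from `(g G_σ, σ)` to `(g a⁻¹ G_τ, τ)`. -/
def development : Scwol.{u} where
  V := Σ σ : Y.V, 𝒢.FundamentalGroup T ⧸ 𝒢.localSubgroup T σ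
  E x y := {a : Y.E x.1 y.1 // 𝒢.move T a x.2 = y.2}
  comp a b := ⟨Y.comp a.1 b.1, by rw [move_comp, b.2, a.2]⟩
  assoc a b c := Subtype.ext (Y.assoc a.1 b.1 c.1)
  no_loop x := ⟨fun a => (Y.no_loop x.1).elim a.1⟩

end ComplexOfGroups

/-! The group `G` acts on the 1-skeleton of the development, which is a connected locally finite
graph. The orbit of the vertex given by the trivial coset of `G_σ` is a copy of `G/G_σ`. Property A
of the graph yields finite sets around the points of this orbit. Moving each of their points to a
nearest orbit point, and recording the original point in the `ℕ`-coordinate, gives almost invariant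
subsets of `(G/G_σ) × ℕ` (`PropertyA.sets_of_graph`). The orbit need not be coarsely dense: the
centre of each set lies in the orbit, so a point within `S` of it moves by less than `S`. Local
finiteness turns the distance bound into a finite set of cosets.

Relative property A for a family follows from a single member: the `G`-set is the disjoint union of
all the coset spaces, and the sets live in one of them (`PropertyASets.relativePropertyA`).

For property A of `G`, finite-dimensionality provides a 0-cell `σ`. Developability makes `G_σ → G`
injective (`IsDevelopable.ι_injective`), so property A of `G_σ` combines with property A relative to
`G/G_σ` (`PropertyAFunctions.of_quotient`). That step multiplies measures, whence the passage
between sets and probability measures (`PropertyASets.functions`, `PropertyAFunctions.sets`). -/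

/-! ## Property A relative to a set with a group action -/

/-- The group `G` has property A relative to the `G`-set `K`: there are almost invariant maps from
`G` to finite subsets of `K × ℕ`, with distances replaced by finite sets. -/
def PropertyASets (G K : Type u) [Group G] [MulAction G K] : Prop :=
  ∀ ε : ℝ, 0 < ε → ∀ E : Set G, E.Finite → ∃ F : Set K, F.Finite ∧ ∃ A : G → Set (K × ℕ),
    (∀ x, (A x).Finite ∧ (A x).Nonempty) ∧
    (∀ x, ∀ p ∈ A x, x⁻¹ • p.1 ∈ F) ∧
    (∀ x y, x⁻¹ * y ∈ E → ((symmDiff (A x) (A y)).ncard : ℝ) / ((A x).ncard : ℝ) < ε)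

/-- The variant of `PropertyASets` with finitely supported probability measures on `K`. -/
def PropertyAFunctions (G K : Type u) [Group G] [MulAction G K] : Prop :=
  ∀ ε : ℝ, 0 < ε → ∀ E : Set G, E.Finite → ∃ F : Set K, F.Finite ∧ ∃ f : G → K → ℝ,
    (∀ x k, 0 ≤ f x k) ∧
    (∀ x k, f x k ≠ 0 → x⁻¹ • k ∈ F) ∧
    (∀ x (t : Finset K), (∀ k, f x k ≠ 0 → k ∈ t) → ∑ k ∈ t, f x k = 1) ∧
    (∀ x y, x⁻¹ * y ∈ E → ∀ t : Finset K, ∑ k ∈ t, |f x k - f y k| ≤ ε)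

/-! ### Fiber counts of finite subsets of `K × ℕ` -/

section Fibers

variable {K : Type*} [DecidableEq K]

/-- The number of points of a finite subset of `K × ℕ` above `k`. -/
def fiberCard (A : Finset (K × ℕ)) (k : K) : ℕ := (A.filter fun p => p.1 = k).card

theorem sum_fiberCard_le (A : Finset (K × ℕ)) (t : Finset K) :
    ∑ k ∈ t, fiberCard A k ≤ A.card := by
  have h := Finset.card_eq_sum_card_fiberwise (f := Prod.fst) (s := A.filter fun p => p.1 ∈ t)
    (t := t) (fun p hp => (Finset.mem_filter.1 hp).2)
  refine le_trans (le_of_eq ?_) (Finset.card_filter_le A fun p => p.1 ∈ t)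
  rw [h]
  refine Finset.sum_congr rfl fun k hk => ?_
  rw [fiberCard, Finset.filter_filter]
  congr 1
  ext p
  simp only [Finset.mem_filter, and_congr_right_iff]
  rintro -
  exact ⟨fun h => ⟨h ▸ hk, h⟩, fun h => h.2⟩

theorem sum_fiberCard_eq (A : Finset (K × ℕ)) (t : Finset K) (h : ∀ p ∈ A, p.1 ∈ t) :
    ∑ k ∈ t, fiberCard A k = A.card :=
  (Finset.card_eq_sum_card_fiberwise (f := Prod.fst) (fun p hp => h p hp)).symm

theorem fiberCard_ne_zero {A : Finset (K × ℕ)} {k : K} :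
    fiberCard A k ≠ 0 ↔ ∃ n, (k, n) ∈ A := by
  rw [fiberCard, Finset.card_ne_zero]
  constructor
  · rintro ⟨⟨a, n⟩, hp⟩
    obtain ⟨h, rfl⟩ := Finset.mem_filter.1 hp
    exact ⟨n, h⟩
  · rintro ⟨n, hn⟩
    exact ⟨(k, n), Finset.mem_filter.2 ⟨hn, rfl⟩⟩

theorem fiberCard_le_add (A B : Finset (K × ℕ)) (k : K) :
    fiberCard A k ≤ fiberCard B k + fiberCard (symmDiff A B) k := by
  refine le_trans (Finset.card_le_card ?_) (Finset.card_union_le _ _)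
  intro p
  simp only [Finset.mem_filter, Finset.mem_union, Finset.mem_symmDiff]
  tauto

theorem abs_fiberCard_sub_le (A B : Finset (K × ℕ)) (k : K) :
    |(fiberCard A k : ℝ) - fiberCard B k| ≤ fiberCard (symmDiff A B) k := by
  have h₁ : (fiberCard A k : ℝ) ≤ fiberCard B k + fiberCard (symmDiff A B) k :=
    mod_cast fiberCard_le_add A B k
  have h₂ : (fiberCard B k : ℝ) ≤ fiberCard A k + fiberCard (symmDiff A B) k := by
    rw [symmDiff_comm]
    exact mod_cast fiberCard_le_add B A k
  rw [abs_le]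
  constructor <;> linarith

theorem abs_card_sub_le (A B : Finset (K × ℕ)) :
    |(A.card : ℝ) - B.card| ≤ (symmDiff A B).card := by
  have key : ∀ A B : Finset (K × ℕ), (A.card : ℝ) ≤ B.card + (symmDiff A B).card := by
    intro A B
    have : A.card ≤ B.card + (symmDiff A B).card := by
      refine le_trans (Finset.card_le_card ?_) (Finset.card_union_le _ _)
      intro p
      simp only [Finset.mem_union, Finset.mem_symmDiff]
      tauto
    exact mod_cast this
  have h₁ := key A B
  have h₂ := key B A
  rw [symmDiff_comm] at h₂
  rw [abs_le]
  constructor <;> linarith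

/-- The difference of the normalized counts splits into a change of the count and a change of the
normalization. Each contributes at most `|A ∆ B| / |A|`, hence the factor 2. -/
theorem sum_abs_normalized_sub_le {A B : Finset (K × ℕ)} (hA : A.Nonempty) (hB : B.Nonempty)
    (t : Finset K) :
    ∑ k ∈ t, |(fiberCard A k : ℝ) / A.card - fiberCard B k / B.card| ≤
      2 * ((symmDiff A B).card / A.card) := by
  have ha : (0 : ℝ) < A.card := mod_cast hA.card_pos
  have hb : (0 : ℝ) < B.card := mod_cast hB.card_pos
  have key : ∀ k ∈ t, |(fiberCard A k : ℝ) / A.card - fiberCard B k / B.card| ≤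
      (fiberCard (symmDiff A B) k : ℝ) * (1 / A.card) +
        fiberCard B k * ((symmDiff A B).card / (A.card * B.card)) := by
    intro k _
    have e : (fiberCard A k : ℝ) / A.card - fiberCard B k / B.card =
        (fiberCard A k - fiberCard B k) * (1 / A.card) +
          fiberCard B k * ((B.card - A.card) / (A.card * B.card)) := by
      field_simp
      ring
    rw [e]
    refine (abs_add_le _ _).trans (add_le_add ?_ ?_)
    · rw [abs_mul, abs_of_pos (one_div_pos.2 ha)]
      exact mul_le_mul_of_nonneg_right (abs_fiberCard_sub_le A B k) (one_div_pos.2 ha).le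
    · rw [abs_mul, abs_div, Nat.abs_cast, abs_of_pos (mul_pos ha hb), abs_sub_comm]
      gcongr
      exact abs_card_sub_le A B
  refine (Finset.sum_le_sum key).trans ?_
  rw [Finset.sum_add_distrib, ← Finset.sum_mul, ← Finset.sum_mul, ← Nat.cast_sum, ← Nat.cast_sum]
  have h₁ : ((∑ k ∈ t, fiberCard (symmDiff A B) k : ℕ) : ℝ) ≤ (symmDiff A B).card :=
    mod_cast sum_fiberCard_le _ t
  have h₂ : ((∑ k ∈ t, fiberCard B k : ℕ) : ℝ) ≤ B.card := mod_cast sum_fiberCard_le _ t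
  calc _ ≤ ((symmDiff A B).card : ℝ) * (1 / A.card) +
        B.card * ((symmDiff A B).card / (A.card * B.card)) := by gcongr
    _ = _ := by field_simp; ring

end Fibers

/-- The measure of `x` is the push-forward to `K` of the uniform measure on `A x`; normalizing costs
the factor 2, hence `ε / 2`. -/
theorem PropertyASets.functions {G K : Type u} [Group G] [MulAction G K]
    (h : PropertyASets G K) : PropertyAFunctions G K := by
  classical
  intro ε hε E hE
  obtain ⟨F, hF, A, hA, hAF, hAE⟩ := h (ε / 2) (half_pos hε) E hE
  let B : G → Finset (K × ℕ) := fun x => (hA x).1.toFinset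
  have hB : ∀ x p, p ∈ B x ↔ p ∈ A x := fun x p => (hA x).1.mem_toFinset
  have hBne : ∀ x, (B x).Nonempty := fun x => (hA x).2.imp fun p hp => (hB x p).2 hp
  have hcoe : ∀ x, (B x : Set (K × ℕ)) = A x := fun x => (hA x).1.coe_toFinset
  have hpos : ∀ x, (0 : ℝ) < (B x).card := fun x => mod_cast (hBne x).card_pos
  refine ⟨F, hF, fun x k => fiberCard (B x) k / (B x).card, fun x k => by positivity, ?_, ?_, ?_⟩
  · intro x k hk
    have : fiberCard (B x) k ≠ 0 := by
      rintro h0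
      simp [h0] at hk
    obtain ⟨n, hn⟩ := fiberCard_ne_zero.1 this
    exact hAF x _ ((hB x _).1 hn)
  · intro x t ht
    rw [← Finset.sum_div, ← Nat.cast_sum, sum_fiberCard_eq, div_self (hpos x).ne']
    intro p hp
    refine ht p.1 (div_ne_zero (Nat.cast_ne_zero.2 ?_) (hpos x).ne')
    exact fiberCard_ne_zero.2 ⟨p.2, hp⟩
  · intro x y hxy t
    have h := hAE x y hxy
    rw [← hcoe, ← hcoe, ← Finset.coe_symmDiff, Set.ncard_coe_finset, Set.ncard_coe_finset] at h
    refine (sum_abs_normalized_sub_le (hBne x) (hBne y) t).trans ?_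
    linarith

/-- The part of `K × ℕ` below the graph of the function `n`. -/
def subgraphOf {K : Type*} (n : K → ℕ) : Set (K × ℕ) := {p | p.2 < n p.1}

theorem subgraphOf_eq_coe {K : Type*} (n : K → ℕ) (t : Finset K) (ht : ∀ k, n k ≠ 0 → k ∈ t) :
    subgraphOf n =
      ↑((t.sigma fun k => Finset.range (n k)).map (Equiv.sigmaEquivProd K ℕ).toEmbedding) := by
  ext ⟨k, m⟩
  simp only [subgraphOf, Set.mem_ofPred_eq, Finset.coe_map, Set.mem_image, Finset.mem_coe,
    Finset.mem_sigma, Finset.mem_range]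
  constructor
  · intro h
    exact ⟨⟨k, m⟩, ⟨ht k (by omega), h⟩, rfl⟩
  · rintro ⟨⟨k', m'⟩, ⟨-, h⟩, e⟩
    obtain ⟨rfl, rfl⟩ := Prod.mk.inj e
    exact h

theorem finite_subgraphOf {K : Type*} (n : K → ℕ) (t : Finset K) (ht : ∀ k, n k ≠ 0 → k ∈ t) :
    (subgraphOf n).Finite := by
  rw [subgraphOf_eq_coe n t ht]
  exact Finset.finite_toSet _

theorem ncard_subgraphOf {K : Type*} (n : K → ℕ) (t : Finset K) (ht : ∀ k, n k ≠ 0 → k ∈ t) :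
    (subgraphOf n).ncard = ∑ k ∈ t, n k := by
  rw [subgraphOf_eq_coe n t ht, Set.ncard_coe_finset, Finset.card_map, Finset.card_sigma]
  simp

/-- Above `k`, the symmetric difference lies in the interval between `min (m k) (n k)` and `max (m
k) (n k)`. -/
theorem ncard_symmDiff_subgraphOf_le {K : Type*} (m n : K → ℕ) (t : Finset K)
    (hm : ∀ k, m k ≠ 0 → k ∈ t) (hn : ∀ k, n k ≠ 0 → k ∈ t) :
    ((symmDiff (subgraphOf m) (subgraphOf n)).ncard : ℝ) ≤ ∑ k ∈ t, |(m k : ℝ) - n k| := by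
  let U : Finset (K × ℕ) := (t.sigma fun k => Finset.Ico (min (m k) (n k)) (max (m k) (n k))).map
    (Equiv.sigmaEquivProd K ℕ).toEmbedding
  have hU : symmDiff (subgraphOf m) (subgraphOf n) ⊆ (U : Set (K × ℕ)) := by
    rintro ⟨k, j⟩ hj
    have hj' : (j < m k ∧ ¬ j < n k) ∨ (j < n k ∧ ¬ j < m k) := hj
    refine Finset.mem_coe.2 (Finset.mem_map.2 ⟨⟨k, j⟩, Finset.mem_sigma.2 ⟨?_, ?_⟩, rfl⟩)
    · rcases hj' with h | h
      · exact hm k (by omega)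
      · exact hn k (by omega)
    · simp only [Finset.mem_Ico]
      omega
  have h := Set.ncard_le_ncard hU U.finite_toSet
  rw [Set.ncard_coe_finset, Finset.card_map, Finset.card_sigma] at h
  refine (Nat.cast_le.2 h).trans (le_of_eq ?_)
  rw [Nat.cast_sum]
  refine Finset.sum_congr rfl fun k _ => ?_
  rw [Nat.card_Ico, Nat.cast_sub min_le_max, Nat.cast_max, Nat.cast_min, max_sub_min_eq_abs']

/-- Scale the measures by a large integer `M`, round down, and take the region below the graph. Each
support lies in a translate of `F`, so the total rounding error is bounded independently of `x` and
of `M`. -/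
theorem PropertyAFunctions.sets {G K : Type u} [Group G] [MulAction G K]
    (h : PropertyAFunctions G K) : PropertyASets G K := by
  classical
  intro ε hε E hE
  obtain ⟨F, hF, f, f_nonneg, f_supp, f_sum, f_close⟩ := h (ε / 4) (by positivity) E hE
  let N : ℝ := hF.toFinset.card
  have hN : 0 ≤ N := Nat.cast_nonneg _
  let B : G → Finset K := fun x => hF.toFinset.image fun k => x • k
  have hB : ∀ x k, f x k ≠ 0 → k ∈ B x := fun x k hk =>
    Finset.mem_image.2 ⟨x⁻¹ • k, hF.mem_toFinset.2 (f_supp x k hk), smul_inv_smul x k⟩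
  have hBcard : ∀ x, ((B x).card : ℝ) ≤ N := fun x =>
    Nat.cast_le.2 Finset.card_image_le
  -- The sets have at least `M - N` points, and the symmetric differences at most `M * (ε / 4) + 2 *
  -- N`. This `M` makes the former positive and the quotient less than `ε`.
  obtain ⟨M, hM⟩ := exists_nat_gt (max N ((2 * N + ε * N) * (2 / ε)))
  have hM₁ : N < M := (le_max_left _ _).trans_lt hM
  have hM₂ : (2 * N + ε * N) * 2 < M * ε := by
    have h := (le_max_right _ _).trans_lt hM
    rwa [← mul_div_assoc, div_lt_iff₀ hε] at h
  let n : G → K → ℕ := fun x k => ⌊M * f x k⌋₊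
  have hnf : ∀ x k, n x k ≠ 0 → f x k ≠ 0 := by
    intro x k hk h0
    simp [n, h0] at hk
  have hn : ∀ x k, n x k ≠ 0 → k ∈ B x := fun x k hk => hB x k (hnf x k hk)
  have hn₁ : ∀ x k, (n x k : ℝ) ≤ M * f x k := fun x k =>
    Nat.floor_le (mul_nonneg (Nat.cast_nonneg _) (f_nonneg x k))
  have hn₂ : ∀ x k, M * f x k < n x k + 1 := fun x k => Nat.lt_floor_add_one _
  have hcard : ∀ x, (M : ℝ) - N ≤ (subgraphOf (n x)).ncard := by
    intro x
    rw [ncard_subgraphOf (n x) (B x) (hn x), Nat.cast_sum]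
    have h : ∑ k ∈ B x, (M * f x k - 1) ≤ ∑ k ∈ B x, (n x k : ℝ) :=
      Finset.sum_le_sum fun k _ => by linarith [hn₂ x k]
    rw [Finset.sum_sub_distrib, ← Finset.mul_sum, f_sum x (B x) (hB x)] at h
    simp only [Finset.sum_const, nsmul_eq_mul, mul_one] at h
    linarith [hBcard x]
  have hpos : ∀ x, (0 : ℝ) < (subgraphOf (n x)).ncard := fun x => by linarith [hcard x]
  refine ⟨F, hF, fun x => subgraphOf (n x), fun x => ⟨finite_subgraphOf _ _ (hn x), ?_⟩, ?_, ?_⟩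
  · by_contra h0
    have := hpos x
    rw [show subgraphOf (n x) = ∅ from Set.not_nonempty_iff_eq_empty.1 h0] at this
    simp at this
  · intro x p hp
    have hp' : p.2 < n x p.1 := hp
    exact f_supp x _ (hnf x _ (by omega))
  · intro x y hxy
    rw [div_lt_iff₀ (hpos x)]
    have h := ncard_symmDiff_subgraphOf_le (n x) (n y) (B x ∪ B y)
      (fun k hk => Finset.mem_union_left _ (hn x k hk))
      (fun k hk => Finset.mem_union_right _ (hn y k hk))
    have h' : ∑ k ∈ B x ∪ B y, |(n x k : ℝ) - n y k| ≤
        ∑ k ∈ B x ∪ B y, (M * |f x k - f y k| + 1) := by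
      refine Finset.sum_le_sum fun k _ => ?_
      have e : (M : ℝ) * |f x k - f y k| = |M * f x k - M * f y k| := by
        rw [← mul_sub, abs_mul, Nat.abs_cast]
      rw [e, abs_le]
      have h₁ := le_abs_self (M * f x k - M * f y k)
      have h₂ := neg_abs_le (M * f x k - M * f y k)
      constructor <;> linarith [hn₁ x k, hn₂ x k, hn₁ y k, hn₂ y k]
    rw [Finset.sum_add_distrib, ← Finset.mul_sum] at h'
    simp only [Finset.sum_const, nsmul_eq_mul, mul_one] at h'
    have h₃ : (((B x ∪ B y).card : ℕ) : ℝ) ≤ N + N := by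
      refine le_trans ?_ (add_le_add (hBcard x) (hBcard y))
      exact mod_cast Finset.card_union_le _ _
    have h₄ : (M : ℝ) * ∑ k ∈ B x ∪ B y, |f x k - f y k| ≤ M * (ε / 4) :=
      mul_le_mul_of_nonneg_left (f_close x y hxy _) (Nat.cast_nonneg _)
    have h₅ : ε * ((M : ℝ) - N) ≤ ε * (subgraphOf (n x)).ncard :=
      mul_le_mul_of_nonneg_left (hcard x) hε.le
    nlinarith [mul_nonneg hε.le hN]

/-! ## Extensions -/

/-- Property A passes from a subgroup, and the cosets of it, to the group. With representatives `s z`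
of the cosets, the mass at `g` is the product of that of its coset and that of its position in it. -/
theorem PropertyAFunctions.of_quotient {G H : Type u} [Group G] [Group H] (i : H →* G)
    (hi : Function.Injective i) (hZ : PropertyAFunctions G (G ⧸ i.range))
    (hH : PropertyAFunctions H H) : PropertyAFunctions G G := by
  classical
  intro ε hε E hE
  obtain ⟨F, hF, a, a_nonneg, a_supp, a_sum, a_close⟩ := hZ (ε / 2) (half_pos hε) E hE
  let s : G ⧸ i.range → G := Quotient.out
  have hs : ∀ z, (s z : G ⧸ i.range) = z := fun z => Quotient.out_eq' z
  -- `x` carries the representative of `x⁻¹ • z` into the coset `z`; `θ z x` is the position at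
  -- which it lands, and the measure placed on `z` is the one that `H` assigns to this position.
  have hθ : ∀ (z : G ⧸ i.range) (x : G), ∃ h : H, i h = (s z)⁻¹ * x * s (x⁻¹ • z) := by
    intro z x
    have : (s z : G ⧸ i.range) = (x * s (x⁻¹ • z) : G) := by
      rw [← smul_eq_mul, ← MulAction.Quotient.smul_coe, hs, hs, smul_inv_smul]
    obtain ⟨h, hh⟩ := QuotientGroup.eq.1 this
    exact ⟨h, by rw [hh, mul_assoc]⟩
  choose θ hθ using hθ
  have hκ : ∀ g : G, ∃ h : H, s (g : G ⧸ i.range) * i h = g := by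
    intro g
    obtain ⟨h, hh⟩ := QuotientGroup.eq.1 (hs (g : G ⧸ i.range))
    exact ⟨h, by rw [hh, mul_inv_cancel_left]⟩
  choose κ hκ using hκ
  have s_mul : ∀ z (h : H), ((s z * i h : G) : G ⧸ i.range) = z := by
    intro z h
    rw [← hs z, QuotientGroup.eq, hs]
    exact ⟨h⁻¹, by rw [map_inv]; group⟩
  have κ_mul : ∀ z (h : H), κ (s z * i h) = h := by
    intro z h
    have := hκ (s z * i h)
    rw [s_mul] at this
    exact hi (mul_left_cancel this)
  -- `D` contains the quotients `(θ z x)⁻¹ * θ z y` with `x⁻¹ * y ∈ E` and `y⁻¹ • z ∈ F`: the `z` in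
  -- the middle cancels, leaving finitely many values.
  let D : Set H := {h | i h ∈ (fun p : G × (G ⧸ i.range) => (s (p.1 • p.2))⁻¹ * p.1 * s p.2) ''
    (E ×ˢ F)}
  have hD : D.Finite := ((hE.prod hF).image _).preimage hi.injOn
  obtain ⟨F', hF', c, c_nonneg, c_supp, c_sum, c_close⟩ := hH (ε / 2) (half_pos hε) D hD
  let f : G → G → ℝ := fun x g => a x g * c (θ g x) (κ g)
  refine ⟨(fun p : (G ⧸ i.range) × H => s p.1 * i p.2) '' (F ×ˢ F'), (hF.prod hF').image _, f,
    fun x g => mul_nonneg (a_nonneg _ _) (c_nonneg _ _), ?_, ?_, ?_⟩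
  · intro x g hg
    have ha := a_supp x g (left_ne_zero_of_mul hg)
    have hc := c_supp _ _ (right_ne_zero_of_mul hg)
    refine ⟨(_, _), ⟨ha, hc⟩, ?_⟩
    simp only [smul_eq_mul, map_mul, map_inv, hθ]
    conv_rhs => rw [← hκ g]
    group
  · intro x t ht
    let tZ : Finset (G ⧸ i.range) := t.image (QuotientGroup.mk (s := i.range))
    let tH : Finset H := t.image κ
    have key : ∑ g ∈ t, f x g = ∑ z ∈ tZ, ∑ h ∈ tH, a x z * c (θ z x) h := by
      rw [← Finset.sum_product' tZ tH fun z h => a x z * c (θ z x) h]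
      refine Finset.sum_of_injOn (fun g => ((g : G ⧸ i.range), κ g)) ?_ ?_ ?_ ?_
      · intro g _ g' _ e
        obtain ⟨e₁, e₂⟩ := Prod.mk.inj e
        rw [← hκ g, ← hκ g', e₁, e₂]
      · intro g hg
        exact Finset.mem_coe.2 (Finset.mem_product.2
          ⟨Finset.mem_image_of_mem _ hg, Finset.mem_image_of_mem _ hg⟩)
      · rintro ⟨z, h⟩ - hzh
        by_contra h0
        refine hzh ⟨s z * i h, ht _ ?_, ?_⟩
        · simpa only [f, s_mul, κ_mul] using h0
        · simp only [s_mul, κ_mul]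
      · intro g _
        rfl
    have hsum : ∀ z ∈ tZ, ∑ h ∈ tH, a x z * c (θ z x) h = a x z := by
      intro z _
      by_cases h0 : a x z = 0
      · simp [h0]
      · rw [← Finset.mul_sum, c_sum, mul_one]
        intro h hh
        refine Finset.mem_image.2 ⟨s z * i h, ht _ ?_, κ_mul z h⟩
        simpa only [f, s_mul, κ_mul] using mul_ne_zero h0 hh
    rw [key, Finset.sum_congr rfl hsum]
    refine a_sum x tZ fun z hz => ?_
    have : ∃ h, c (θ z x) h ≠ 0 := by
      by_contra! h0
      have := c_sum (θ z x) ∅ (fun h hh => absurd (h0 h) hh)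
      simp at this
    obtain ⟨h, hh⟩ := this
    refine Finset.mem_image.2 ⟨s z * i h, ht _ ?_, s_mul z h⟩
    simpa only [f, s_mul, κ_mul] using mul_ne_zero hz hh
  · intro x y hxy t
    let tZ : Finset (G ⧸ i.range) := t.image (QuotientGroup.mk (s := i.range))
    -- `U` contains the positions of the points of `t`, and also the supports of the measures `c (θ
    -- z x)` for `z ∈ tZ`, so that these have total mass 1 on `U`.
    let U : Finset H := t.image κ ∪
      (tZ.biUnion fun z => (hF'.image fun h => θ z x * h).toFinset)
    have hU : ∀ z ∈ tZ, ∀ h, c (θ z x) h ≠ 0 → h ∈ U := by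
      intro z hz h hh
      refine Finset.mem_union_right _ (Finset.mem_biUnion.2 ⟨z, hz, ?_⟩)
      exact (Set.Finite.mem_toFinset _).2 ⟨_, c_supp _ _ hh, smul_inv_smul (θ z x) h⟩
    have key : ∑ g ∈ t, |f x g - f y g| ≤
        ∑ z ∈ tZ, ∑ h ∈ U, |a x z * c (θ z x) h - a y z * c (θ z y) h| := by
      rw [← Finset.sum_product' tZ U fun z h => |a x z * c (θ z x) h - a y z * c (θ z y) h|]
      rw [← Finset.sum_image (s := t) (g := fun g => ((g : G ⧸ i.range), κ g))
        (f := fun q => |a x q.1 * c (θ q.1 x) q.2 - a y q.1 * c (θ q.1 y) q.2|)]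
      · refine Finset.sum_le_sum_of_subset_of_nonneg ?_ fun _ _ _ => abs_nonneg _
        intro q hq
        obtain ⟨g, hg, rfl⟩ := Finset.mem_image.1 hq
        exact Finset.mem_product.2 ⟨Finset.mem_image_of_mem _ hg,
          Finset.mem_union_left _ (Finset.mem_image_of_mem _ hg)⟩
      · intro g _ g' _ e
        obtain ⟨e₁, e₂⟩ := Prod.mk.inj e
        rw [← hκ g, ← hκ g', e₁, e₂]
    have hfib : ∀ z ∈ tZ, ∑ h ∈ U, |a x z * c (θ z x) h - a y z * c (θ z y) h| ≤
        |a x z - a y z| + a y z * (ε / 2) := by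
      intro z hz
      have h₁ : ∀ h ∈ U, |a x z * c (θ z x) h - a y z * c (θ z y) h| ≤
          |a x z - a y z| * c (θ z x) h + a y z * |c (θ z x) h - c (θ z y) h| := by
        intro h _
        have e : a x z * c (θ z x) h - a y z * c (θ z y) h =
          (a x z - a y z) * c (θ z x) h + a y z * (c (θ z x) h - c (θ z y) h) := by ring
        rw [e]
        refine (abs_add_le _ _).trans (le_of_eq ?_)
        rw [abs_mul, abs_mul, abs_of_nonneg (c_nonneg _ _), abs_of_nonneg (a_nonneg _ _)]
      refine (Finset.sum_le_sum h₁).trans ?_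
      rw [Finset.sum_add_distrib, ← Finset.mul_sum, ← Finset.mul_sum, c_sum _ U (hU z hz), mul_one]
      -- Only cosets charged by `a y` need the estimate in `H`, and for these `y⁻¹ • z ∈ F`, as
      -- membership in `D` requires.
      by_cases h0 : a y z = 0
      · simp [h0]
      · refine add_le_add le_rfl (mul_le_mul_of_nonneg_left (c_close _ _ ?_ U) (a_nonneg _ _))
        refine ⟨(x⁻¹ * y, y⁻¹ • z), ⟨hxy, a_supp y z h0⟩, ?_⟩
        simp only [map_mul, map_inv, hθ, smul_smul, mul_inv_cancel_right]
        group
    refine key.trans ((Finset.sum_le_sum hfib).trans ?_)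
    rw [Finset.sum_add_distrib, ← Finset.sum_mul]
    have h₂ : ∑ z ∈ tZ, a y z ≤ 1 := by
      let W : Finset (G ⧸ i.range) := tZ ∪ (hF.image fun z => y • z).toFinset
      rw [← a_sum y W fun z hz => Finset.mem_union_right _
        ((Set.Finite.mem_toFinset _).2 ⟨_, a_supp y z hz, smul_inv_smul y z⟩)]
      exact Finset.sum_le_sum_of_subset_of_nonneg Finset.subset_union_left
        fun _ _ _ => a_nonneg _ _
    have h₃ := a_close x y hxy tZ
    nlinarith

/-! ## Proper lengths -/

theorem ProperLength.len_nonneg {G : Type u} [Group G] (ℓ : ProperLength G) (g : G) :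
    0 ≤ ℓ.len g := by
  have h := ℓ.len_mul_le g g⁻¹
  rw [mul_inv_cancel, (ℓ.len_eq_zero_iff 1).2 rfl, ℓ.len_inv] at h
  linarith

theorem Set.Finite.exists_pos_forall_lt {α : Type*} {s : Set α} (hs : s.Finite) (f : α → ℝ) :
    ∃ r : ℝ, 0 < r ∧ ∀ a ∈ s, f a < r := by
  obtain ⟨r, hr⟩ := (hs.image f).bddAbove
  refine ⟨max r 0 + 1, by positivity, fun a ha => ?_⟩
  have := hr (Set.mem_image_of_mem f ha)
  linarith [le_max_left r 0]

/-- Balls of a proper length are finite and finite sets are bounded. So bounds by radii and by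
finite sets are interchangeable, and the choice of the length is immaterial. -/
theorem HasPropertyA.sets {G : Type u} [Group G] (h : HasPropertyA G) : PropertyASets G G := by
  obtain ⟨ℓ, h⟩ := h
  intro ε hε E hE
  obtain ⟨R, hR, hER⟩ := hE.exists_pos_forall_lt ℓ.len
  obtain ⟨S, -, A, hA, hAS, hAE⟩ := h ε hε R hR
  exact ⟨{g | ℓ.len g ≤ S}, ℓ.finite_ball S, A, hA, fun x p hp => (hAS x p hp).le,
    fun x y hxy => hAE x y (hER _ hxy)⟩

theorem PropertyASets.propertyA {G : Type u} [Group G] (h : PropertyASets G G)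
    (ℓ : ProperLength G) : PropertyA ℓ.dist := by
  intro ε hε R _
  obtain ⟨F, hF, A, hA, hAF, hAE⟩ := h ε hε _ (ℓ.finite_ball R)
  obtain ⟨S, hS, hFS⟩ := hF.exists_pos_forall_lt ℓ.len
  exact ⟨S, hS, A, hA, fun x p hp => hFS _ (hAF x p hp), fun x y hxy => hAE x y (le_of_lt hxy)⟩

open scoped Pointwise in
/-- A finitely generated group has a proper length, namely a word length. -/
theorem nonempty_properLength_of_fg (G : Type u) [Group G] [hG : Group.FG G] :
    Nonempty (ProperLength G) := by
  classical
  obtain ⟨s, hs⟩ := hG.out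
  let t : Finset G := s ∪ s⁻¹
  have ht : t⁻¹ = t := by
    ext g
    simp [t, Finset.mem_inv', or_comm]
  have hex : ∀ g : G, ∃ n : ℕ, g ∈ t ^ n := by
    intro g
    have hg : g ∈ Subgroup.closure (s : Set G) := by rw [hs]; trivial
    induction hg using Subgroup.closure_induction with
    | mem x hx => exact ⟨1, by rw [pow_one]; exact Finset.mem_union_left _ hx⟩
    | one => exact ⟨0, by simp⟩
    | mul x y _ _ hx hy =>
      obtain ⟨m, hm⟩ := hx
      obtain ⟨n, hn⟩ := hy
      exact ⟨m + n, by rw [pow_add]; exact Finset.mul_mem_mul hm hn⟩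
    | inv x _ hx =>
      obtain ⟨m, hm⟩ := hx
      exact ⟨m, by rw [← ht, inv_pow]; exact Finset.inv_mem_inv hm⟩
  let len : G → ℕ := fun g => Nat.find (hex g)
  have hlen : ∀ g, g ∈ t ^ len g := fun g => Nat.find_spec (hex g)
  have hle : ∀ g n, g ∈ t ^ n → len g ≤ n := fun g n h => Nat.find_min' (hex g) h
  have hinv : ∀ g, len g⁻¹ ≤ len g := by
    intro g
    refine hle _ _ ?_
    rw [← ht, inv_pow]
    exact Finset.inv_mem_inv (hlen g)
  refine ⟨⟨fun g => len g, fun g => ?_, fun g => ?_, fun g h => ?_, fun r => ?_⟩⟩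
  · rw [Nat.cast_eq_zero]
    constructor
    · intro h
      have := hlen g
      rw [h] at this
      simpa using this
    · rintro rfl
      exact Nat.le_zero.1 (hle _ _ (by simp))
  · have := hinv g⁻¹
    rw [inv_inv] at this
    exact congrArg _ (le_antisymm (hinv g) this)
  · have := hle (g * h) _ (by rw [pow_add]; exact Finset.mul_mem_mul (hlen g) (hlen h))
    exact mod_cast this
  · refine Set.Finite.subset ((Set.finite_Iic ⌊r⌋₊).biUnion fun n _ => (t ^ n).finite_toSet) ?_
    intro g hg
    exact Set.mem_biUnion (Set.mem_Iic.2 (Nat.le_floor hg)) (hlen g)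

theorem Group.FG.countable (G : Type u) [Group G] [Group.FG G] : Countable G := by
  obtain ⟨ℓ⟩ := nonempty_properLength_of_fg G
  rw [← Set.countable_univ_iff]
  refine Set.Countable.mono ?_ (Set.countable_iUnion fun n : ℕ => (ℓ.finite_ball n).countable)
  intro g _
  exact Set.mem_iUnion.2 (exists_nat_ge (ℓ.len g))

/-! ## Relative property A from one orbit -/

/-- Each index gets its own orbit, the coset space of its subgroup, represented by the trivial
coset, even if subgroups repeat or are conjugate. The sets need not meet every orbit, so they are
all placed in the one of `j`. -/
theorem PropertyASets.relativePropertyA {G : Type u} [Group G] [Countable G] {J : Type u}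
    [Finite J] (H : J → Subgroup G) (j : J) (h : PropertyASets G (G ⧸ H j))
    (ℓ : ProperLength G) : RelativePropertyA ℓ H := by
  let q : G ⧸ H j → Σ j, G ⧸ H j := fun c => ⟨j, c⟩
  have hq : Function.Injective q := fun _ _ h => by simpa [q] using h
  have orbit : ∀ (i : J) (g : G),
      (g • ⟨i, ((1 : G) : G ⧸ H i)⟩ : Σ j, G ⧸ H j) = ⟨i, (g : G ⧸ H i)⟩ := by
    intro i g
    rw [Sigma.smul_mk, MulAction.Quotient.smul_coe, smul_eq_mul, mul_one]
  have exists_rep : ∀ k : Σ j, G ⧸ H j, ∃ g : G, k = g • ⟨k.1, ((1 : G) : G ⧸ H k.1)⟩ := by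
    rintro ⟨i, c⟩
    induction c using QuotientGroup.induction_on with
    | H g => exact ⟨g, (orbit i g).symm⟩
  have stab : ∀ i, MulAction.stabilizer G (⟨i, ((1 : G) : G ⧸ H i)⟩ : Σ j, G ⧸ H j) =
      H i := by
    intro i
    ext g
    rw [MulAction.mem_stabilizer_iff, orbit, Sigma.mk.injEq, heq_eq_eq, eq_comm (a := (g : G ⧸ H i)),
      QuotientGroup.eq, inv_one, one_mul]
    exact and_iff_right rfl
  have countable_quotient : ∀ i, Countable (G ⧸ H i) := fun i => Quotient.countable
  refine ⟨Σ j, G ⧸ H j, inferInstance, inferInstance, ?_, ?_,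
    Set.range fun i => ⟨i, ((1 : G) : G ⧸ H i)⟩, ?_, ?_⟩
  · refine Finite.of_surjective
      (fun i : J => (Quotient.mk'' (⟨i, ((1 : G) : G ⧸ H i)⟩ : Σ j, G ⧸ H j) :
        MulAction.orbitRel.Quotient G (Σ j, G ⧸ H j))) fun c => ?_
    induction c using Quotient.inductionOn' with
    | h k =>
      obtain ⟨g, hg⟩ := exists_rep k
      refine ⟨k.1, Quotient.sound' ?_⟩
      rw [MulAction.orbitRel_apply, MulAction.mem_orbit_symm]
      exact ⟨g, hg.symm⟩
  · ext L
    constructor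
    · rintro ⟨k, rfl⟩
      obtain ⟨g, hg⟩ := exists_rep k
      refine ⟨k.1, g, ?_⟩
      dsimp only
      rw [← stab, ← MulAction.stabilizer_smul_eq_stabilizer_map_conj, ← hg]
    · rintro ⟨i, g, rfl⟩
      refine ⟨g • ⟨i, ((1 : G) : G ⧸ H i)⟩, ?_⟩
      dsimp only
      rw [MulAction.stabilizer_smul_eq_stabilizer_map_conj, stab]
  · intro k
    obtain ⟨g, hg⟩ := exists_rep k
    refine ⟨⟨k.1, ((1 : G) : G ⧸ H k.1)⟩, ⟨⟨k.1, rfl⟩, ?_⟩, ?_⟩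
    · rw [MulAction.mem_orbit_symm]
      exact ⟨g, hg.symm⟩
    · rintro _ ⟨⟨i, rfl⟩, g', hg'⟩
      have : i = k.1 := (congrArg Sigma.fst hg').symm
      subst this
      rfl
  · intro ε hε R _
    obtain ⟨F, hF, A, hA, hAF, hAE⟩ := h ε hε _ (ℓ.finite_ball R)
    -- The length of any element of the coset `x⁻¹ • c` bounds the infimum in `relRho`; `S` exceeds
    -- the lengths of the chosen elements of the finitely many cosets in `F`.
    obtain ⟨S, hS, hFS⟩ := hF.exists_pos_forall_lt fun c => ℓ.len c.out
    have hqq : Function.Injective (Prod.map q (id : ℕ → ℕ)) := hq.prodMap Function.injective_id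
    refine ⟨S, hS, fun x => Prod.map q id '' A x,
      fun x => ⟨(hA x).1.image _, (hA x).2.image _⟩, ?_, ?_⟩
    · rintro x _ ⟨⟨c, n⟩, hp, rfl⟩
      refine lt_of_le_of_lt (csInf_le ⟨0, ?_⟩ ?_) (hFS _ (hAF x _ hp))
      · rintro _ ⟨g, -, rfl⟩
        exact ℓ.len_nonneg g
      · refine ⟨(x⁻¹ • c).out, ⟨_, ⟨j, rfl⟩, ?_⟩, rfl⟩
        dsimp only
        rw [orbit, QuotientGroup.out_eq']
        rfl
    · intro x y hxy
      rw [← Set.image_symmDiff hqq, Set.ncard_image_of_injective _ hqq,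
        Set.ncard_image_of_injective _ hqq]
      exact hAE x y (le_of_lt hxy)

/-! ## Groups acting on graphs with property A -/

theorem SimpleGraph.finite_setOf_walk_length_eq {V : Type*} {Γ : SimpleGraph V}
    (h : ∀ v, (Γ.neighborSet v).Finite) (n : ℕ) (v : V) :
    {w | ∃ p : Γ.Walk v w, p.length = n}.Finite := by
  induction n generalizing v with
  | zero =>
    refine (Set.finite_singleton v).subset ?_
    rintro w ⟨p, hp⟩
    exact (SimpleGraph.Walk.eq_of_length_eq_zero hp).symm
  | succ n ih =>
    refine ((h v).biUnion fun u _ => ih u).subset ?_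
    rintro w ⟨p, hp⟩
    cases p with
    | nil => simp at hp
    | cons hu p =>
      refine Set.mem_biUnion (show _ ∈ Γ.neighborSet v from hu) ⟨p, ?_⟩
      simpa using hp

theorem SimpleGraph.Connected.finite_setOf_dist_lt {V : Type*} {Γ : SimpleGraph V}
    (hΓ : Γ.Connected) (h : ∀ v, (Γ.neighborSet v).Finite) (v : V) (r : ℝ) :
    {w | (Γ.dist v w : ℝ) < r}.Finite := by
  refine ((Set.finite_Iic ⌊r⌋₊).biUnion fun n _ =>
    Γ.finite_setOf_walk_length_eq h n v).subset fun w hw => ?_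
  obtain ⟨p, hp⟩ := hΓ.exists_walk_length_eq_dist v w
  exact Set.mem_biUnion (Set.mem_Iic.2 (Nat.le_floor (le_of_lt hw))) ⟨p, hp⟩

theorem SimpleGraph.Connected.dist_smul {G V : Type*} [Group G] [MulAction G V]
    {Γ : SimpleGraph V} (hΓ : Γ.Connected) (h : ∀ (g : G) {v w}, Γ.Adj v w → Γ.Adj (g • v) (g • w))
    (g : G) (v w : V) : Γ.dist (g • v) (g • w) = Γ.dist v w := by
  have key : ∀ (g : G) (v w : V), Γ.dist (g • v) (g • w) ≤ Γ.dist v w := by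
    intro g v w
    obtain ⟨p, hp⟩ := hΓ.exists_walk_length_eq_dist v w
    let f : Γ →g Γ := ⟨fun v => g • v, fun hvw => h g hvw⟩
    rw [← hp, ← SimpleGraph.Walk.length_map f p]
    exact SimpleGraph.dist_le _
  refine le_antisymm (key g v w) ?_
  simpa using key g⁻¹ (g • v) (g • w)

/-- A countable group which acts on a connected locally finite graph with property A has property A
relative to every orbit. -/
theorem PropertyA.sets_of_graph {G K V : Type u} [Group G] [Countable G] [MulAction G K]
    [MulAction G V] {Γ : SimpleGraph V} (hΓ : Γ.Connected)
    (hfin : ∀ v, (Γ.neighborSet v).Finite)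
    (hadj : ∀ (g : G) {v w}, Γ.Adj v w → Γ.Adj (g • v) (g • w))
    (hA : PropertyA fun v w : V => (Γ.dist v w : ℝ))
    (q : K → V) (hq : Function.Injective q) (hqG : ∀ (g : G) k, q (g • k) = g • q k) (k₀ : K) :
    PropertyASets G K := by
  intro ε hε E hE
  have hdist := hΓ.dist_smul hadj
  obtain ⟨R, hR, hER⟩ := hE.exists_pos_forall_lt fun g => (Γ.dist (q k₀) (g • q k₀) : ℝ)
  obtain ⟨S, hS, B, hB, hBS, hBR⟩ := hA ε hε R hR
  -- Projection to a nearest point of the image of `K`.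
  have hproj : ∀ v, ∃ k, ∀ k', Γ.dist v (q k) ≤ Γ.dist v (q k') := by
    intro v
    have : Nonempty K := ⟨k₀⟩
    exact ⟨Function.argmin fun k => Γ.dist v (q k),
      fun k' => Function.argmin_le (fun k => Γ.dist v (q k)) k'⟩
  choose p hp using hproj
  -- Many points may project to the same `k`. An injective code of all the points in use, as second
  -- coordinate, keeps them apart and preserves the cardinalities; the sets form a countable family
  -- since `G` is countable.
  obtain ⟨e, he⟩ := Set.countable_iff_exists_injOn.1
    (Set.countable_iUnion fun x : G => (hB (x • q k₀)).1.countable)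
  let φ : V × ℕ → K × ℕ := fun w => (p w.1, e w)
  have hφ : ∀ x : G, Set.InjOn φ (B (x • q k₀)) := fun x a ha b hb hab =>
    he (Set.mem_iUnion.2 ⟨x, ha⟩) (Set.mem_iUnion.2 ⟨x, hb⟩) (Prod.mk.inj hab).2
  -- The radius is `S + S`: a point of `B (x • q k₀)` is within `S` of the centre, and its
  -- projection is no farther from it than the centre, which is itself in the image of `K`.
  refine ⟨{k | (Γ.dist (q k₀) (q k) : ℝ) < S + S},
    (hΓ.finite_setOf_dist_lt hfin (q k₀) (S + S)).preimage hq.injOn,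
    fun x => φ '' B (x • q k₀), fun x => ⟨(hB _).1.image _, (hB _).2.image _⟩, ?_, ?_⟩
  · rintro x _ ⟨w, hw, rfl⟩
    have h₁ := hBS _ _ hw
    have h₂ : (Γ.dist w.1 (q (p w.1)) : ℝ) ≤ Γ.dist w.1 (x • q k₀) := by
      rw [← hqG]
      exact mod_cast hp w.1 (x • k₀)
    have h₃ : (Γ.dist (x • q k₀) (q (p w.1)) : ℝ) ≤
        Γ.dist (x • q k₀) w.1 + Γ.dist w.1 (q (p w.1)) := mod_cast hΓ.dist_triangle
    rw [SimpleGraph.dist_comm (v := x • q k₀)] at h₂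
    have h₄ : Γ.dist (q k₀) (q (x⁻¹ • p w.1)) = Γ.dist (x • q k₀) (q (p w.1)) := by
      rw [← hdist x, hqG, smul_inv_smul]
    rw [Set.mem_ofPred_eq, h₄]
    dsimp only at h₁
    linarith
  · intro x y hxy
    have h := hBR (x • q k₀) (y • q k₀) (by
      have := hER _ hxy
      rwa [← hdist x, smul_smul, mul_inv_cancel_left] at this)
    rw [(hφ x).ncard_image]
    refine lt_of_le_of_lt (div_le_div_of_nonneg_right ?_ (Nat.cast_nonneg _)) h
    have hsub : symmDiff (φ '' B (x • q k₀)) (φ '' B (y • q k₀)) ⊆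
        φ '' symmDiff (B (x • q k₀)) (B (y • q k₀)) := by
      rintro _ (⟨⟨w, hw, rfl⟩, hn⟩ | ⟨⟨w, hw, rfl⟩, hn⟩)
      · exact ⟨w, Or.inl ⟨hw, fun h' => hn ⟨w, h', rfl⟩⟩, rfl⟩
      · exact ⟨w, Or.inr ⟨hw, fun h' => hn ⟨w, h', rfl⟩⟩, rfl⟩
    have hf : (symmDiff (B (x • q k₀)) (B (y • q k₀))).Finite :=
      (hB _).1.symmDiff (hB _).1
    exact mod_cast (Set.ncard_le_ncard hsub (hf.image φ)).trans (Set.ncard_image_le hf)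

/-! ## Potentials on trees -/

/-- `t v` is the product of the weights along the path from a root to `v`. For adjacent vertices,
one of the two paths extends the other by the edge between them. -/
theorem SimpleGraph.IsTree.exists_potential {V : Type*} {Γ : SimpleGraph V} (hΓ : Γ.IsTree)
    {A : Type*} [Group A] (w : V → V → A) (hw : ∀ u v, Γ.Adj u v → w v u = (w u v)⁻¹) :
    ∃ t : V → A, ∀ u v, Γ.Adj u v → t v = t u * w u v := by
  obtain ⟨r⟩ := hΓ.connected.nonempty
  choose p hp _ using fun v => hΓ.existsUnique_path r v
  let wt : ∀ {v}, Γ.Walk r v → A := fun q => (q.darts.map fun d => w d.fst d.snd).prod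
  have wt_concat : ∀ {u v} (q : Γ.Walk r u) (h : Γ.Adj u v), wt (q.concat h) = wt q * w u v := by
    intro u v q h
    simp [wt, SimpleGraph.Walk.darts_concat, List.concat_eq_append]
  refine ⟨fun v => wt (p v), fun u v huv => ?_⟩
  dsimp only
  by_cases h : u ∈ (p v).support
  · rw [hΓ.isAcyclic.path_concat (hp u) (hp v) huv h, wt_concat]
  · have h' := hΓ.isAcyclic.mem_support_of_ne_mem_support_of_adj_of_isPath (hp u) (hp v) huv h
    rw [hΓ.isAcyclic.path_concat (hp v) (hp u) huv.symm h', wt_concat, hw u v huv,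
      inv_mul_cancel_right]

namespace ComplexOfGroups

variable {Y : Scwol.{u}} (𝒢 : ComplexOfGroups Y) (T : Set Y.Edge)

/-! ## The action on the development -/

instance : MulAction (𝒢.FundamentalGroup T) (𝒢.development T).V :=
  inferInstanceAs (MulAction (𝒢.FundamentalGroup T)
    (Σ σ : Y.V, 𝒢.FundamentalGroup T ⧸ 𝒢.localSubgroup T σ))

/-- The vertex of the development given by a coset of a local group. -/
def devVertex (σ : Y.V) (c : 𝒢.FundamentalGroup T ⧸ 𝒢.localSubgroup T σ) :
    (𝒢.development T).V := ⟨σ, c⟩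

theorem smul_devVertex (g : 𝒢.FundamentalGroup T) (σ : Y.V)
    (c : 𝒢.FundamentalGroup T ⧸ 𝒢.localSubgroup T σ) :
    g • 𝒢.devVertex T σ c = 𝒢.devVertex T σ (g • c) := rfl

theorem devVertex_injective (σ : Y.V) : Function.Injective (𝒢.devVertex T σ) := by
  intro c d h
  obtain ⟨-, h⟩ := Sigma.mk.inj h
  exact eq_of_heq h

theorem smul_devVertex_one (g : 𝒢.FundamentalGroup T) (σ : Y.V) :
    g • 𝒢.devVertex T σ (1 : 𝒢.FundamentalGroup T) = 𝒢.devVertex T σ g := by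
  rw [smul_devVertex, MulAction.Quotient.smul_coe, smul_eq_mul, mul_one]

/-- Left translation commutes with right multiplication by `a⁻¹`; this makes `G` act on the edges of
the development. -/
theorem move_smul {σ τ : Y.V} (a : Y.E σ τ) (g : 𝒢.FundamentalGroup T)
    (c : 𝒢.FundamentalGroup T ⧸ 𝒢.localSubgroup T σ) :
    𝒢.move T a (g • c) = g • 𝒢.move T a c := by
  induction c using Quotient.inductionOn' with
  | h x => exact congrArg (QuotientGroup.mk (s := 𝒢.localSubgroup T τ)) (mul_assoc _ _ _)

theorem development_adj_iff (x y : (𝒢.development T).V) :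
    (𝒢.development T).skeleton.Adj x y ↔
      Nonempty ((𝒢.development T).E x y) ∨ Nonempty ((𝒢.development T).E y x) := by
  simp [Scwol.skeleton, Scwol.graphOf]

theorem development_adj_smul (g : 𝒢.FundamentalGroup T) {x y : (𝒢.development T).V}
    (h : (𝒢.development T).skeleton.Adj x y) :
    (𝒢.development T).skeleton.Adj (g • x) (g • y) := by
  have key : ∀ {x y : (𝒢.development T).V}, Nonempty ((𝒢.development T).E x y) →
      Nonempty ((𝒢.development T).E (g • x) (g • y)) := by
    rintro x y ⟨a, ha⟩
    refine ⟨⟨a, ?_⟩⟩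
    have := 𝒢.move_smul T a g x.2
    rw [ha] at this
    exact this
  rw [development_adj_iff] at h ⊢
  exact h.imp key key

theorem development_adj_of_edge {σ τ : Y.V} (a : Y.E σ τ) :
    (𝒢.development T).skeleton.Adj (𝒢.devVertex T σ (1 : 𝒢.FundamentalGroup T))
      (𝒢.devVertex T τ ((𝒢.edgeElt T a)⁻¹ : 𝒢.FundamentalGroup T)) := by
  rw [development_adj_iff]
  refine Or.inl ⟨⟨a, ?_⟩⟩
  exact congrArg (QuotientGroup.mk (s := 𝒢.localSubgroup T τ)) (one_mul _)

theorem edgeElt_of_mem {σ τ : Y.V} (a : Y.E σ τ) (ha : Y.edge a ∈ T) : 𝒢.edgeElt T a = 1 :=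
  PresentedGroup.mk_eq_one_iff.2
    (Subgroup.subset_normalClosure (show _ ∈ {r | 𝒢.Rel T r} from Rel.tree a ha))

/-- Edges of `T` are trivial in the fundamental group, so the tree lifts to the development through
the trivial cosets. -/
theorem reachable_devVertex_one (hT : Y.IsMaximalTree T) (σ τ : Y.V) :
    (𝒢.development T).skeleton.Reachable (𝒢.devVertex T σ (1 : 𝒢.FundamentalGroup T))
      (𝒢.devVertex T τ (1 : 𝒢.FundamentalGroup T)) := by
  have key : ∀ {σ τ : Y.V} (a : Y.E σ τ), Y.edge a ∈ T →
      (𝒢.development T).skeleton.Reachable (𝒢.devVertex T σ (1 : 𝒢.FundamentalGroup T))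
        (𝒢.devVertex T τ (1 : 𝒢.FundamentalGroup T)) := by
    intro σ τ a ha
    have h := 𝒢.development_adj_of_edge T a
    rw [𝒢.edgeElt_of_mem T a ha, inv_one] at h
    exact h.reachable
  obtain ⟨p⟩ := hT.1.connected.preconnected σ τ
  induction p with
  | nil => exact SimpleGraph.Reachable.refl _
  | cons h _ ih =>
    refine SimpleGraph.Reachable.trans ?_ ih
    rcases h with ⟨a, ha⟩ | ⟨a, ha⟩
    · exact key a ha
    · exact (key a ha).symm

/-- Every generator keeps the base vertices in their component: an element of `G_σ` fixes the base
vertex over `σ`, and an edge element `a` moves the base vertex over its initial vertex to a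
neighbour of the one over its terminal vertex. -/
theorem development_connected (hT : Y.IsMaximalTree T) :
    (𝒢.development T).skeleton.Connected := by
  have reach_smul : ∀ (g : 𝒢.FundamentalGroup T) {x y : (𝒢.development T).V},
      (𝒢.development T).skeleton.Reachable x y →
        (𝒢.development T).skeleton.Reachable (g • x) (g • y) := by
    intro g x y h
    exact h.map (⟨fun x => g • x, fun h => 𝒢.development_adj_smul T g h⟩ :
      (𝒢.development T).skeleton →g (𝒢.development T).skeleton)
  obtain ⟨o⟩ := hT.1.connected.nonempty
  let b : Y.V → (𝒢.development T).V := fun σ => 𝒢.devVertex T σ (1 : 𝒢.FundamentalGroup T)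
  have hb : ∀ σ τ, (𝒢.development T).skeleton.Reachable (b σ) (b τ) :=
    𝒢.reachable_devVertex_one T hT
  -- It suffices that a group element moves one base vertex within a component.
  have upgrade : ∀ (g : 𝒢.FundamentalGroup T) (σ τ : Y.V),
      (𝒢.development T).skeleton.Reachable (b σ) (g • b τ) →
        (𝒢.development T).skeleton.Reachable (b o) (g • b o) := fun g σ τ h =>
    (hb o σ).trans (h.trans (reach_smul g (hb τ o)))
  have all : ∀ g : 𝒢.FundamentalGroup T,
      (𝒢.development T).skeleton.Reachable (b o) (g • b o) := by
    intro g
    have hg : g ∈ Subgroup.closure (Set.range (PresentedGroup.of (rels := {r | 𝒢.Rel T r}))) := by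
      rw [PresentedGroup.closure_range_of]
      trivial
    induction hg using Subgroup.closure_induction with
    | mem x hx =>
      obtain ⟨⟨σ, x⟩ | ⟨σ, τ, a⟩, rfl⟩ := hx
      · refine upgrade _ σ σ ?_
        rw [smul_devVertex_one]
        have : ((PresentedGroup.of (rels := {r | 𝒢.Rel T r}) (Sum.inl ⟨σ, x⟩) :
            𝒢.FundamentalGroup T) : 𝒢.FundamentalGroup T ⧸ 𝒢.localSubgroup T σ) =
            ((1 : 𝒢.FundamentalGroup T) : 𝒢.FundamentalGroup T ⧸ 𝒢.localSubgroup T σ) := by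
          rw [eq_comm, QuotientGroup.eq, inv_one, one_mul]
          exact ⟨x, rfl⟩
        rw [this]
      · refine upgrade _ τ σ ?_
        have h := reach_smul (𝒢.edgeElt T a) (𝒢.development_adj_of_edge T a).reachable
        rw [← 𝒢.smul_devVertex_one T (𝒢.edgeElt T a)⁻¹, smul_inv_smul] at h
        exact h.symm
    | one => rw [one_smul]
    | mul x y _ _ hx hy =>
      rw [mul_smul]
      exact hx.trans (reach_smul x hy)
    | inv x _ hx =>
      have h := reach_smul x⁻¹ hx
      rw [inv_smul_smul] at h
      exact h.symm
  have base : ∀ x : (𝒢.development T).V, (𝒢.development T).skeleton.Reachable (b o) x := by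
    rintro ⟨σ, c⟩
    induction c using QuotientGroup.induction_on with
    | H g =>
      have h := (all g).trans (reach_smul g (hb o σ))
      rw [smul_devVertex_one] at h
      exact h
  exact { preconnected := fun x y => (base x).symm.trans (base y), nonempty := ⟨b o⟩ }

/-! ## Developable complexes of groups have injective local groups -/

variable {𝒢 T} in
-- The maps `φ` and elements `h` in `Γ` satisfy all the relations except those of the tree.
-- Conjugation by a potential on the tree makes `h a` trivial for `a ∈ T`. The resulting
-- homomorphism to `Γ` restricts to a conjugate of the injective `φ σ`.
theorem IsDevelopable.ι_injective (h𝒢 : 𝒢.IsDevelopable) (hT : Y.IsMaximalTree T) (σ : Y.V) :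
    Function.Injective (𝒢.ι T σ) := by
  classical
  obtain ⟨Γ, _, X, ρ, p, s, h, φ, -, -, -, -, hinj, -, hψ, htw⟩ := h𝒢
  -- Chosen so that a potential satisfies `t τ = t σ * (h a)⁻¹` for an edge `a ∈ T` from `σ` to `τ`;
  -- the value 1 off the tree plays no role.
  let w : Y.V → Y.V → Γ := fun x y =>
    if hxy : ∃ a : Y.E x y, Y.edge a ∈ T then (h hxy.choose)⁻¹
    else if hyx : ∃ a : Y.E y x, Y.edge a ∈ T then h hyx.choose else 1
  have hloop : ∀ {x y : Y.V}, Y.E x y → Y.E y x → False :=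
    fun {x y} a b => (Y.no_loop x).elim (Y.comp b a)
  have w₁ : ∀ {x y : Y.V} (a : Y.E x y), Y.edge a ∈ T → w x y = (h a)⁻¹ := by
    intro x y a ha
    have hxy : ∃ a : Y.E x y, Y.edge a ∈ T := ⟨a, ha⟩
    simp only [w, dif_pos hxy]
    rw [hT.2 _ a hxy.choose_spec ha]
  have w₂ : ∀ {x y : Y.V} (a : Y.E x y), Y.edge a ∈ T → w y x = h a := by
    intro x y a ha
    have hxy : ∃ a : Y.E x y, Y.edge a ∈ T := ⟨a, ha⟩
    have hyx : ¬ ∃ a : Y.E y x, Y.edge a ∈ T := fun ⟨b, _⟩ => hloop a b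
    simp only [w, dif_neg hyx, dif_pos hxy]
    rw [hT.2 _ a hxy.choose_spec ha]
  obtain ⟨t, ht⟩ := hT.1.exists_potential w (by
    rintro x y (⟨a, ha⟩ | ⟨a, ha⟩)
    · rw [w₁ a ha, w₂ a ha, inv_inv]
    · rw [w₁ a ha, w₂ a ha])
  let f : 𝒢.Gen → Γ := Sum.elim (fun g => t g.1 * φ g.1 g.2 * (t g.1)⁻¹)
    fun e => t e.2.1 * h e.2.2 * (t e.1)⁻¹
  have fV : ∀ {σ : Y.V} (g : 𝒢.grp σ), FreeGroup.lift f (𝒢.genV g) = t σ * φ σ g * (t σ)⁻¹ :=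
    fun g => FreeGroup.lift_apply_of
  have fE : ∀ {σ τ : Y.V} (a : Y.E σ τ), FreeGroup.lift f (𝒢.genE a) = t τ * h a * (t σ)⁻¹ :=
    fun a => FreeGroup.lift_apply_of
  have hf : ∀ r ∈ {r | 𝒢.Rel T r}, FreeGroup.lift f r = 1 := by
    rintro r (⟨g, g'⟩ | ⟨a, g⟩ | ⟨a, b⟩ | ⟨a, ha⟩)
    · simp only [map_mul, map_inv, fV]
      group
    · simp only [map_mul, map_inv, fV, fE, hψ]
      group
    · simp only [map_mul, map_inv, fV, fE, htw]
      group
    · rw [fE, ht _ _ (Or.inl ⟨a, ha⟩), w₁ a ha]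
      group
  have key : ∀ g : 𝒢.grp σ, PresentedGroup.toGroup hf (𝒢.ι T σ g) = t σ * φ σ g * (t σ)⁻¹ := fV
  intro g g' hgg
  refine hinj σ ?_
  have := congrArg (PresentedGroup.toGroup hf) hgg
  rw [key, key] at this
  exact mul_left_cancel (mul_right_cancel this)

end ComplexOfGroups

namespace Scwol

/-- Otherwise edges could be followed forever, giving composable sequences of every length. -/
theorem IsFiniteDimensional.exists_isZeroCell {Y : Scwol.{u}} (hY : Y.IsFiniteDimensional)
    [Nonempty Y.V] : ∃ σ, Y.IsZeroCell σ := by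
  obtain ⟨n, hn⟩ := hY
  by_contra! h
  have hnext : ∀ σ, ∃ τ, Nonempty (Y.E σ τ) := by
    intro σ
    have := h σ
    simpa [IsZeroCell] using this
  choose f hf using hnext
  obtain ⟨o⟩ := ‹Nonempty Y.V›
  have := hn (n + 1) (fun i => f^[i] o) fun i => by
    have := hf (f^[i] o)
    rw [← Function.iterate_succ_apply' f] at this
    simpa using this
  omega

theorem IsLocallyFinite.finite_neighborSet {X : Scwol.{u}} (hX : X.IsLocallyFinite) (x : X.V) :
    (X.skeleton.neighborSet x).Finite := by
  have := (hX x).1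
  have := (hX x).2
  refine ((Set.finite_range fun e : Σ y, X.E x y => e.1).union
    (Set.finite_range fun e : Σ y, X.E y x => e.1)).subset ?_
  rintro y (⟨a, -⟩ | ⟨a, -⟩)
  · exact Or.inl ⟨⟨y, a⟩, rfl⟩
  · exact Or.inr ⟨⟨y, a⟩, rfl⟩

end Scwol

theorem ComplexOfGroups.propertyASets_quotient {Y : Scwol.{u}} (𝒢 : ComplexOfGroups Y)
    (T : Set Y.Edge) (hT : Y.IsMaximalTree T) [Group.FG (𝒢.FundamentalGroup T)]
    (hlf : (𝒢.development T).IsLocallyFinite) (hA : PropertyA (𝒢.development T).vertexDist)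
    (σ : Y.V) :
    PropertyASets (𝒢.FundamentalGroup T) (𝒢.FundamentalGroup T ⧸ 𝒢.localSubgroup T σ) := by
  have := Group.FG.countable (𝒢.FundamentalGroup T)
  exact PropertyA.sets_of_graph (𝒢.development_connected T hT) hlf.finite_neighborSet
    (fun g _ _ h => 𝒢.development_adj_smul T g h) hA (𝒢.devVertex T σ)
    (𝒢.devVertex_injective T σ) (fun _ _ => rfl) (1 : 𝒢.FundamentalGroup T)

theorem mainTheorem6 (Y : Scwol.{u}) (hdim : Y.IsFiniteDimensional) (𝒢 : ComplexOfGroups Y)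
    (hdev : 𝒢.IsDevelopable) (T : Set Y.Edge) (hT : Y.IsMaximalTree T)
    (hfg : Group.FG (𝒢.FundamentalGroup T))
    (hlf : (𝒢.development T).IsLocallyFinite)
    (hA : PropertyA (𝒢.development T).vertexDist) :
    (∀ (ℓ : ProperLength (𝒢.FundamentalGroup T)) (J : Type u) [Finite J] [Nonempty J]
        (v : J → Y.V),
      RelativePropertyA ℓ fun j => 𝒢.localSubgroup T (v j)) ∧
    ((∀ σ : Y.V, Y.IsZeroCell σ → HasPropertyA (𝒢.grp σ)) →
      HasPropertyA (𝒢.FundamentalGroup T)) := by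
  constructor
  · intro ℓ J _ _ v
    have := Group.FG.countable (𝒢.FundamentalGroup T)
    -- Any one member of the family can carry the sets.
    obtain ⟨j⟩ := ‹Nonempty J›
    exact (𝒢.propertyASets_quotient T hT hlf hA (v j)).relativePropertyA
      (fun j => 𝒢.localSubgroup T (v j)) j ℓ
  · intro h
    have := hT.1.connected.nonempty
    obtain ⟨σ, hσ⟩ := hdim.exists_isZeroCell
    obtain ⟨ℓ⟩ := nonempty_properLength_of_fg (𝒢.FundamentalGroup T)
    have hquot := (𝒢.propertyASets_quotient T hT hlf hA σ).functions
    have hG := PropertyAFunctions.of_quotient (𝒢.ι T σ) (hdev.ι_injective hT σ) hquot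
      (h σ hσ).sets.functions
    exact ⟨ℓ, hG.sets.propertyA ℓ⟩
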